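/- Let $A$ be a finite, linearly ordered alphabet and let $\mathbf S=(S_n)_{n\ge 1}$ be a stationary (not necessarily ergodic) $A$-valued process, with law $m$ on $A^{\mathbb N}$; let $\sigma$ be the left shift on $A^{\mathbb N}$. All logarithms are to base $2$. For a $\sigma$-invariant probability measure $p$ on $A^{\mathbb N}$ let $H_p(S_1^L)$ be the Shannon entropy of the first $L$ letters under $p$, let $R_n=|\{1\le i\le n: s_i\le s_n\}|$ be the rank of the $n$-th letter, and let $H_p(R_1^L)$ be the Shannon entropy of the word $R_1\dots R_L$ under $p$. Put $$h_p(\mathbf S)=\lim_{L\to\infty}\tfrac1L H_p(S_1^L),\qquad h_p^*(\mathbf S)=\lim_{L\to\infty}\tfrac1{L-1}H_p(R_1^L),$$ the latter whenever the limit exists. An ergodic decomposition of $m$ is a measurable family $\{m_s:s\in A^{\mathbb N}\}$ of probability measures on $A^{\mathbb N}$ such that $m(C)=\int m_s(C)\,dm(s)$ for all measurable $C$ and, for $m$-almost every $s$, $m_s$ is $\sigma$-invariant and ergodic, $m_{\sigma(s)}=m_s$, and $m_s(\{t:m_t=m_s\})=1$. Suppose that the limit defining $h_m^*(\mathbf S)$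 exists. Then the limit defining $h_m(\mathbf S)$ exists and $$h_m^*(\mathbf S)\ \ge\ h_m(\mathbf S).$$ Moreover, $m$ has an ergodic decomposition, and for every ergodic decomposition $\{m_s\}$ of $m$ the limit $h_{m_s}^*(\mathbf S)$ exists for $m$-almost every $s$, is $m$-integrable as a function of $s$, and $$h_m^*(\mathbf S)\ \ge\ \int_{A^{\mathbb N}}h_{m_s}^*(\mathbf S)\,dm(s).$$ -/

import Mathlib

open MeasureTheory ProbabilityTheory Filter Topology

noncomputable section

/-- The law on sequence space of a process `S` on `(Ω, μ)`: the sequence space model of `S`. -/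
def sourceModel {Ω A : Type*} [MeasurableSpace Ω] [MeasurableSpace A]
    (μ : Measure Ω) (S : ℕ → Ω → A) : Measure (ℕ → A) :=
  μ.map (fun ω n => S n ω)

/-- A process is stationary if all its time shifts have the same law. -/
def IsStationaryProcess {Ω A : Type*} [MeasurableSpace Ω] [MeasurableSpace A]
    (μ : Measure Ω) (S : ℕ → Ω → A) : Prop :=
  ∀ k : ℕ, μ.map (fun ω n => S (n + k) ω) = μ.map (fun ω n => S n ω)

/-- The left shift on one-sided sequences. -/
def leftShift {A : Type*} (s : ℕ → A) : ℕ → A := fun n => s (n + 1)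

/-- The Shannon entropy, in bits, of a random variable with values in a finite set;
`0 * log 0 = 0` holds by the value of `Real.logb` at zero. -/
def shannonEntropy {Ω β : Type*} [MeasurableSpace Ω] [Fintype β]
    (m : Measure Ω) (X : Ω → β) : ℝ :=
  -∑ b, m.real (X ⁻¹' {b}) * Real.logb 2 (m.real (X ⁻¹' {b}))

/-- The word formed by the first `L` letters of a sequence. Time starts at `0`. -/
def firstWord {A : Type*} (L : ℕ) (s : ℕ → A) : Fin L → A := fun i => s i

/-- The entropy of order `L`: the entropy of the first `L` letters, divided by `L`. -/
def orderEntropy {A : Type*} [Fintype A] [MeasurableSpace A]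
    (m : Measure (ℕ → A)) (L : ℕ) : ℝ :=
  (1 / (L : ℝ)) * shannonEntropy m (firstWord (A := A) L)

/-- The entropy rate of the source with sequence space model `m`. -/
def entropyRate {A : Type*} [Fintype A] [MeasurableSpace A] (m : Measure (ℕ → A)) : ℝ :=
  limUnder atTop (orderEntropy m)

/-- The rank of the letter at time `n` among the letters up to and including time `n`. -/
def letterRank {A : Type*} [LinearOrder A] (s : ℕ → A) (n : ℕ) : ℕ :=
  ((Finset.range (n + 1)).filter (fun i => s i ≤ s n)).card

theorem letterRank_le {A : Type*} [LinearOrder A] (s : ℕ → A) (n : ℕ) : letterRank s n ≤ n + 1 :=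
  (Finset.card_filter_le _ _).trans (Finset.card_range _).le

/-- The word of the first `L` ranks, all of which lie in `{1, …, L}`. -/
def rankWord {A : Type*} [LinearOrder A] (L : ℕ) (s : ℕ → A) : Fin L → Fin (L + 1) :=
  fun i => ⟨letterRank s i, by have := letterRank_le s i; have := i.isLt; omega⟩

/-- The permutation entropy of order `L` (meaningful for `2 ≤ L`): the entropy of the first
`L` ranks, divided by `L - 1`. -/
def permutationEntropy {A : Type*} [LinearOrder A] [MeasurableSpace A]
    (m : Measure (ℕ → A)) (L : ℕ) : ℝ :=
  (1 / ((L : ℝ) - 1)) * shannonEntropy m (rankWord (A := A) L)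

/-- The permutation entropy rate of the source with sequence space model `m`
(meaningful when the limit exists). -/
def permutationEntropyRate {A : Type*} [LinearOrder A] [MeasurableSpace A]
    (m : Measure (ℕ → A)) : ℝ :=
  limUnder atTop (permutationEntropy m)

/-- `κ`, that is, the family of measures `κ s` indexed by the sequences themselves, is an
ergodic decomposition of the shift-invariant measure `m`. The components of the underlying
partition of the sequence space are the sets `{t | κ t = κ s}`. -/
structure IsErgodicDecomposition {A : Type*} [MeasurableSpace A]
    (m : Measure (ℕ → A)) (κ : Kernel (ℕ → A) (ℕ → A)) : Prop where
  isMarkovKernel : IsMarkovKernel κ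
  /-- almost every `κ s` is shift-invariant and ergodic -/
  ergodic : ∀ᵐ s ∂m, Ergodic (leftShift (A := A)) (κ s)
  /-- the components are shift-invariant -/
  shift_eq : ∀ᵐ s ∂m, κ (leftShift s) = κ s
  /-- `κ s` is concentrated on the component of `s` -/
  concentrated : ∀ᵐ s ∂m, ∀ᵐ t ∂(κ s), κ t = κ s
  /-- `m` is the mixture of the measures `κ s` -/
  mixture : ∀ C : Set (ℕ → A), MeasurableSet C → m C = ∫⁻ s, κ s C ∂m

end

/-!
The permutation entropy rate of *every* stationary source over a finite alphabet exists and equals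
its entropy rate; ergodicity plays no role in this. The ranks of the first `L` letters are a
function of these letters. Conversely, the ranks together with the number of occurrences of each
letter determine the letters (`apply_eq_of_card_filter_le_eq_of_letterRank_eq`): the rank of the
last letter is the number of letters not exceeding it, which identifies it, and one proceeds
backwards. As the letter counts take at most `(L + 1) ^ |A|` values, the two entropies differ by
at most `|A| * log (L + 1)`, which is negligible against `L` (`tendsto_permutationEntropy`). The
entropy rate itself exists by subadditivity of the block entropies and Fekete's lemma.

It follows that the integral inequality is one between entropy rates. It holds for the entropies
of each finite order by Jensen's inequality (`integral_shannonEntropy_le`), and passes to the limit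
by dominated convergence.

An ergodic decomposition is obtained by conditioning `m` on the `σ`-algebra of invariant sets.
That almost every conditional measure is ergodic (`ae_ergodic_condExpKernel_invariants`) follows
from the mean ergodic theorem: for each set `C` of a countable generating `π`-system, a subsequence
of the visit frequencies to `C` converges almost everywhere. Its limit is an invariant function,
hence constant for almost every conditional measure, and this forces every invariant set to be
independent of `C`, hence of itself.
-/

/-! ### Shannon entropy of finitely valued maps -/

theorem shannonEntropy_eq_sum_negMulLog {Ω β : Type*} [MeasurableSpace Ω] [Fintype β]
    (m : Measure Ω) (X : Ω → β) :
    shannonEntropy m X = (∑ b, Real.negMulLog (m.real (X ⁻¹' {b}))) / Real.log 2 := by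
  simp only [shannonEntropy, Real.negMulLog, Real.logb, Finset.sum_div, ← Finset.sum_neg_distrib]
  exact Finset.sum_congr rfl fun b _ => by ring

/-- **Gibbs' inequality**, for a weight `q` of total mass at most that of `p`. -/
theorem sum_negMulLog_le_neg_sum_mul_log {ι : Type*} [Fintype ι] (p q : ι → ℝ)
    (hp : ∀ i, 0 ≤ p i) (hq : ∀ i, 0 ≤ q i) (hpq : ∀ i, q i = 0 → p i = 0)
    (hsum : ∑ i, q i ≤ ∑ i, p i) :
    ∑ i, Real.negMulLog (p i) ≤ -∑ i, p i * Real.log (q i) := by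
  have key : ∀ i, Real.negMulLog (p i) + p i * Real.log (q i) ≤ q i - p i := by
    intro i
    rcases (hp i).eq_or_lt with h | h
    · simpa [← h] using hq i
    · have hq' : 0 < q i := (hq i).lt_of_ne fun h0 => h.ne' (hpq i h0.symm)
      have h1 := Real.log_le_sub_one_of_pos (div_pos hq' h)
      rw [Real.log_div hq'.ne' h.ne'] at h1
      have h2 := mul_le_mul_of_nonneg_left h1 h.le
      have h3 : p i * (q i / p i - 1) = q i - p i := by field_simp
      simp only [Real.negMulLog]
      linarith
  have := Finset.sum_le_sum fun i (_ : i ∈ Finset.univ) => key i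
  rw [Finset.sum_add_distrib, Finset.sum_sub_distrib] at this
  linarith

section

variable {Ω β γ : Type*} [MeasurableSpace Ω] [Fintype β] {m : Measure Ω}

theorem sum_measureReal_fiber [IsProbabilityMeasure m] {X : Ω → β}
    (hX : ∀ b, MeasurableSet (X ⁻¹' {b})) : ∑ b, m.real (X ⁻¹' {b}) = 1 := by
  rw [sum_measureReal_preimage_singleton _ fun b _ => hX b]
  simp

theorem measureReal_fiber_comp [IsFiniteMeasure m] [DecidableEq γ] {X : Ω → β}
    (hX : ∀ b, MeasurableSet (X ⁻¹' {b})) (f : β → γ) (c : γ) :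
    m.real ((f ∘ X) ⁻¹' {c}) = ∑ b with f b = c, m.real (X ⁻¹' {b}) := by
  rw [sum_measureReal_preimage_singleton _ fun b _ => hX b]
  congr 1
  ext ω
  simp

theorem shannonEntropy_nonneg [IsProbabilityMeasure m] (X : Ω → β) : 0 ≤ shannonEntropy m X := by
  rw [shannonEntropy_eq_sum_negMulLog]
  exact div_nonneg (Finset.sum_nonneg fun b _ =>
    Real.negMulLog_nonneg measureReal_nonneg measureReal_le_one) (Real.log_nonneg one_le_two)

theorem shannonEntropy_le_log_card [IsProbabilityMeasure m] {X : Ω → β}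
    (hX : ∀ b, MeasurableSet (X ⁻¹' {b})) :
    shannonEntropy m X ≤ Real.logb 2 (Fintype.card β) := by
  have hne : Nonempty β := (nonempty_of_isProbabilityMeasure m).map X
  have hcard : (0 : ℝ) < Fintype.card β := by exact_mod_cast Fintype.card_pos
  rw [shannonEntropy_eq_sum_negMulLog, Real.logb]
  refine div_le_div_of_nonneg_right ?_ (Real.log_nonneg one_le_two)
  refine (sum_negMulLog_le_neg_sum_mul_log _ (fun _ => (Fintype.card β : ℝ)⁻¹)
    (fun _ => measureReal_nonneg) (fun _ => by positivity)
    (fun _ h => absurd h (by positivity)) ?_).trans_eq ?_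
  · rw [sum_measureReal_fiber hX]
    simp [hcard.ne']
  · rw [← Finset.sum_mul, sum_measureReal_fiber hX, Real.log_inv]
    ring

variable [Fintype γ]

theorem shannonEntropy_comp_le [IsProbabilityMeasure m] {X : Ω → β}
    (hX : ∀ b, MeasurableSet (X ⁻¹' {b})) (f : β → γ) :
    shannonEntropy m (f ∘ X) ≤ shannonEntropy m X := by
  have := Classical.decEq γ
  rw [shannonEntropy_eq_sum_negMulLog, shannonEntropy_eq_sum_negMulLog]
  refine div_le_div_of_nonneg_right ?_ (Real.log_nonneg one_le_two)
  have h1 : ∀ c, Real.negMulLog (m.real ((f ∘ X) ⁻¹' {c})) =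
      ∑ b with f b = c, -(m.real (X ⁻¹' {b}) * Real.log (m.real ((f ∘ X) ⁻¹' {f b}))) := by
    intro c
    rw [Finset.sum_congr rfl (g := fun b =>
      m.real (X ⁻¹' {b}) * -Real.log (m.real ((f ∘ X) ⁻¹' {c})))]
    · rw [← Finset.sum_mul, ← measureReal_fiber_comp hX, Real.negMulLog]
      ring
    · intro b hb
      rw [(Finset.mem_filter.1 hb).2]
      ring
  rw [Finset.sum_congr rfl fun c _ => h1 c, Finset.sum_fiberwise]
  refine Finset.sum_le_sum fun b _ => ?_
  rcases (measureReal_nonneg (μ := m) (s := X ⁻¹' {b})).eq_or_lt with h | h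
  · simp [← h]
  · have hle : m.real (X ⁻¹' {b}) ≤ m.real ((f ∘ X) ⁻¹' {f b}) :=
      measureReal_mono fun ω hω => by
        simp only [Set.mem_preimage, Set.mem_singleton_iff, Function.comp_apply] at hω ⊢
        rw [hω]
    have := mul_le_mul_of_nonneg_left (Real.log_le_log h hle) h.le
    rw [Real.negMulLog]
    linarith

theorem shannonEntropy_le_of_factorsThrough [IsProbabilityMeasure m] {X : Ω → β} {Y : Ω → γ}
    (hX : ∀ b, MeasurableSet (X ⁻¹' {b})) (h : Y.FactorsThrough X) :
    shannonEntropy m Y ≤ shannonEntropy m X := by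
  have hne : Nonempty γ := (nonempty_of_isProbabilityMeasure m).map Y
  obtain ⟨f, rfl⟩ := (Function.factorsThrough_iff Y).1 h
  exact shannonEntropy_comp_le hX f

theorem shannonEntropy_prodMk_le [IsProbabilityMeasure m] {X : Ω → β} {Y : Ω → γ}
    (hX : ∀ b, MeasurableSet (X ⁻¹' {b})) (hY : ∀ c, MeasurableSet (Y ⁻¹' {c})) :
    shannonEntropy m (fun ω => (X ω, Y ω)) ≤ shannonEntropy m X + shannonEntropy m Y := by
  classical
  set Z : Ω → β × γ := fun ω => (X ω, Y ω) with hZdef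
  have hZ : ∀ z, MeasurableSet (Z ⁻¹' {z}) := by
    intro z
    have : Z ⁻¹' {z} = X ⁻¹' {z.1} ∩ Y ⁻¹' {z.2} := by
      ext ω
      simp [hZdef, Prod.ext_iff]
    rw [this]
    exact (hX _).inter (hY _)
  have hfst : ∀ b, ∑ c, m.real (Z ⁻¹' {(b, c)}) = m.real (X ⁻¹' {b}) := by
    intro b
    rw [show X = Prod.fst ∘ Z from rfl, measureReal_fiber_comp hZ, Finset.sum_filter,
      Fintype.sum_prod_type]
    simp only
    rw [Finset.sum_eq_single b (fun b' _ hb' => by simp [hb']) (by simp)]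
    simp
  have hsnd : ∀ c, ∑ b, m.real (Z ⁻¹' {(b, c)}) = m.real (Y ⁻¹' {c}) := by
    intro c
    rw [show Y = Prod.snd ∘ Z from rfl, measureReal_fiber_comp hZ, Finset.sum_filter,
      Fintype.sum_prod_type_right]
    simp only
    rw [Finset.sum_eq_single c (fun b' _ hb' => by simp [hb']) (by simp)]
    simp
  have hleX : ∀ z : β × γ, m.real (Z ⁻¹' {z}) ≤ m.real (X ⁻¹' {z.1}) := fun z => by
    rw [← hfst z.1]
    exact Finset.single_le_sum (f := fun c => m.real (Z ⁻¹' {(z.1, c)}))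
      (fun _ _ => measureReal_nonneg) (Finset.mem_univ z.2)
  have hleY : ∀ z : β × γ, m.real (Z ⁻¹' {z}) ≤ m.real (Y ⁻¹' {z.2}) := fun z => by
    rw [← hsnd z.2]
    exact Finset.single_le_sum (f := fun b => m.real (Z ⁻¹' {(b, z.2)}))
      (fun _ _ => measureReal_nonneg) (Finset.mem_univ z.1)
  simp only [shannonEntropy_eq_sum_negMulLog]
  rw [← add_div]
  refine div_le_div_of_nonneg_right ?_ (Real.log_nonneg one_le_two)
  -- compare the joint law with the product of its marginals
  refine (sum_negMulLog_le_neg_sum_mul_log _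
    (fun z => m.real (X ⁻¹' {z.1}) * m.real (Y ⁻¹' {z.2}))
    (fun _ => measureReal_nonneg) (fun _ => by positivity) ?_ ?_).trans_eq ?_
  · intro z hz
    rcases mul_eq_zero.1 hz with h | h
    · exact le_antisymm (h ▸ hleX z) measureReal_nonneg
    · exact le_antisymm (h ▸ hleY z) measureReal_nonneg
  · rw [sum_measureReal_fiber hZ, Fintype.sum_prod_type]
    simp only [← Finset.mul_sum, sum_measureReal_fiber hY, mul_one, sum_measureReal_fiber hX]
    exact le_rfl
  · have h1 : ∀ z : β × γ, m.real (Z ⁻¹' {z}) *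
        Real.log (m.real (X ⁻¹' {z.1}) * m.real (Y ⁻¹' {z.2})) =
        m.real (Z ⁻¹' {z}) * Real.log (m.real (X ⁻¹' {z.1})) +
        m.real (Z ⁻¹' {z}) * Real.log (m.real (Y ⁻¹' {z.2})) := by
      intro z
      rcases (measureReal_nonneg (μ := m) (s := Z ⁻¹' {z})).eq_or_lt with h | h
      · simp [← h]
      · rw [Real.log_mul (h.trans_le (hleX z)).ne' (h.trans_le (hleY z)).ne', mul_add]
    rw [Finset.sum_congr rfl fun z _ => h1 z, Finset.sum_add_distrib, Fintype.sum_prod_type,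
      Fintype.sum_prod_type_right]
    simp only [← Finset.sum_mul, hfst, hsnd, Real.negMulLog, neg_mul, Finset.sum_neg_distrib]
    ring

end

/-! ### Ranks and letter counts determine the letters -/

section

variable {A : Type*}

theorem firstWord_eq_iff {L : ℕ} {s t : ℕ → A} :
    firstWord L s = firstWord L t ↔ ∀ i < L, s i = t i :=
  ⟨fun h i hi => congrFun h ⟨i, hi⟩, fun h => funext fun i => h i i.2⟩

variable [LinearOrder A]

theorem letterRank_congr {n : ℕ} {s t : ℕ → A} (h : ∀ i ≤ n, s i = t i) :
    letterRank s n = letterRank t n := by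
  unfold letterRank
  congr 1
  refine Finset.filter_congr fun i hi => ?_
  rw [h i (Nat.lt_succ_iff.1 (Finset.mem_range.1 hi)), h n le_rfl]

theorem rankWord_factorsThrough_firstWord (L : ℕ) :
    (rankWord (A := A) L).FactorsThrough (firstWord L) := by
  intro s t h
  rw [firstWord_eq_iff] at h
  funext i
  exact Fin.ext (letterRank_congr fun j hj => h j (hj.trans_lt i.2))

/-- The number of letters at most `a` among the first `L` letters, as a function of `a`. -/
def cumulativeCount (L : ℕ) (s : ℕ → A) : A → Fin (L + 1) := fun a =>
  ⟨((Finset.range L).filter fun i => s i ≤ a).card,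
    Nat.lt_succ_of_le ((Finset.card_filter_le _ _).trans_eq (Finset.card_range L))⟩

theorem cumulativeCount_factorsThrough_firstWord (L : ℕ) :
    (cumulativeCount (A := A) L).FactorsThrough (firstWord L) := by
  intro s t h
  rw [firstWord_eq_iff] at h
  funext a
  refine Fin.ext ?_
  change ((Finset.range L).filter fun i => s i ≤ a).card =
    ((Finset.range L).filter fun i => t i ≤ a).card
  congr 1
  refine Finset.filter_congr fun i hi => ?_
  rw [h i (Finset.mem_range.1 hi)]

/-- The last letter is read off first: its rank is the cumulative count at its value, and a
larger value of the last letter would have a strictly larger cumulative count. -/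
theorem apply_eq_of_card_filter_le_eq_of_letterRank_eq {s t : ℕ → A} {L : ℕ}
    (hc : ∀ a, ((Finset.range L).filter fun i => s i ≤ a).card =
      ((Finset.range L).filter fun i => t i ≤ a).card)
    (hr : ∀ n < L, letterRank s n = letterRank t n) : ∀ i < L, s i = t i := by
  induction L with
  | zero => simp
  | succ L ih =>
    have key : ∀ u v : ℕ → A,
        (∀ a, ((Finset.range (L + 1)).filter fun i => u i ≤ a).card =
          ((Finset.range (L + 1)).filter fun i => v i ≤ a).card) →
        letterRank u L = letterRank v L → v L ≤ u L := by
      intro u v huv hrank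
      by_contra! hlt
      have h1 : ((Finset.range (L + 1)).filter fun i => v i ≤ u L) ⊂
          (Finset.range (L + 1)).filter fun i => v i ≤ v L := by
        refine (Finset.ssubset_iff_of_subset
          (Finset.monotone_filter_right _ fun i _ hi => hi.trans hlt.le)).2 ⟨L, ?_, ?_⟩
        · simp
        · simp [hlt]
      have h2 := Finset.card_lt_card h1
      rw [← huv] at h2
      exact absurd hrank h2.ne
    have hL : s L = t L :=
      le_antisymm (key t s (fun a => (hc a).symm) (hr L L.lt_succ_self).symm)
        (key s t hc (hr L L.lt_succ_self))
    have hlt : ∀ i < L, s i = t i := by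
      refine ih (fun a => ?_) fun n hn => hr n (hn.trans L.lt_succ_self)
      have := hc a
      rw [Finset.range_add_one, Finset.filter_insert, Finset.filter_insert, hL] at this
      split_ifs at this with ha
      · rw [Finset.card_insert_of_notMem (by simp), Finset.card_insert_of_notMem (by simp)] at this
        exact Nat.succ_injective this
      · exact this
    intro i hi
    rcases (Nat.lt_succ_iff.1 hi).eq_or_lt with rfl | h
    · exact hL
    · exact hlt i h

theorem firstWord_factorsThrough_rankWord_cumulativeCount (L : ℕ) :
    (firstWord (A := A) L).FactorsThrough fun s => (rankWord L s, cumulativeCount L s) := by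
  intro s t h
  rw [Prod.mk.injEq] at h
  refine firstWord_eq_iff.2 (apply_eq_of_card_filter_le_eq_of_letterRank_eq (fun a => ?_)
    fun n hn => ?_)
  · exact congrArg Fin.val (congrFun h.2 a)
  · exact congrArg Fin.val (congrFun h.1 ⟨n, hn⟩)

end

/-! ### Entropy rates of stationary sources -/

section

theorem leftShift_iterate_apply {A : Type*} (k : ℕ) (s : ℕ → A) (n : ℕ) :
    leftShift^[k] s n = s (n + k) := by
  induction k generalizing s with
  | zero => rfl
  | succ k ih =>
    rw [Function.iterate_succ_apply, ih]
    rfl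

variable {A : Type*} [MeasurableSpace A]

theorem measurable_leftShift : Measurable (leftShift (A := A)) :=
  measurable_pi_lambda _ fun n => measurable_pi_apply (n + 1)

theorem measurable_firstWord (L : ℕ) : Measurable (firstWord (A := A) L) :=
  measurable_pi_lambda _ fun i => measurable_pi_apply (i : ℕ)

theorem measurableSet_firstWord_fiber [MeasurableSingletonClass A] (L : ℕ) (w : Fin L → A) :
    MeasurableSet (firstWord L ⁻¹' {w}) :=
  (measurableSet_singleton w).preimage (measurable_firstWord L)

variable [Fintype A]

variable {p : Measure (ℕ → A)} [IsProbabilityMeasure p]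

theorem orderEntropy_nonneg (L : ℕ) : 0 ≤ orderEntropy p L :=
  mul_nonneg (by positivity) (shannonEntropy_nonneg _)

variable [MeasurableSingletonClass A]

theorem measurableSet_preimage_of_factorsThrough_firstWord {β : Type*} {L : ℕ}
    {X : (ℕ → A) → β} (h : X.FactorsThrough (firstWord L)) (B : Set β) :
    MeasurableSet (X ⁻¹' B) := by
  have : X ⁻¹' B = firstWord L ⁻¹' (firstWord L '' (X ⁻¹' B)) := by
    refine (Set.subset_preimage_image _ _).antisymm ?_
    rintro s ⟨t, ht, hst⟩
    rw [Set.mem_preimage, ← h hst]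
    exact ht
  rw [this]
  exact (Set.toFinite _).measurableSet.preimage (measurable_firstWord L)

theorem subadditive_shannonEntropy_firstWord (hp : MeasurePreserving leftShift p p) :
    Subadditive fun L => shannonEntropy p (firstWord (A := A) L) := by
  intro k l
  have hshift : shannonEntropy p (firstWord (A := A) l ∘ leftShift^[k]) =
      shannonEntropy p (firstWord (A := A) l) := by
    simp only [shannonEntropy, Set.preimage_comp, measureReal_def]
    simp only [(hp.iterate k).measure_preimage
      (measurableSet_firstWord_fiber l _).nullMeasurableSet]
  have hfib : ∀ w, MeasurableSet ((firstWord (A := A) l ∘ leftShift^[k]) ⁻¹' {w}) := fun w =>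
    (measurableSet_firstWord_fiber l w).preimage (measurable_leftShift.iterate k)
  refine (shannonEntropy_le_of_factorsThrough (m := p)
    (X := fun s => (firstWord k s, (firstWord l ∘ leftShift^[k]) s)) (fun z => ?_) ?_).trans
    ((shannonEntropy_prodMk_le (measurableSet_firstWord_fiber k) hfib).trans_eq (by rw [hshift]))
  · have : (fun s => (firstWord k s, (firstWord l ∘ leftShift^[k]) s)) ⁻¹' {z} =
        firstWord k ⁻¹' {z.1} ∩ (firstWord l ∘ leftShift^[k]) ⁻¹' {z.2} := by
      ext s
      simp [Prod.ext_iff]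
    rw [this]
    exact (measurableSet_firstWord_fiber k _).inter (hfib _)
  · intro s t h
    rw [Prod.mk.injEq, Function.comp_apply, Function.comp_apply, firstWord_eq_iff,
      firstWord_eq_iff] at h
    refine firstWord_eq_iff.2 fun i hi => ?_
    rcases lt_or_ge i k with hik | hik
    · exact h.1 i hik
    · have := h.2 (i - k) (by omega)
      rwa [leftShift_iterate_apply, leftShift_iterate_apply, Nat.sub_add_cancel hik] at this

theorem orderEntropy_le_log_card (L : ℕ) : orderEntropy p L ≤ Real.logb 2 (Fintype.card A) := by
  have hne : Nonempty A := (nonempty_of_isProbabilityMeasure p).map fun s => s 0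
  have hlog : 0 ≤ Real.logb 2 (Fintype.card A) :=
    Real.logb_nonneg one_lt_two (by exact_mod_cast Fintype.card_pos)
  rcases L.eq_zero_or_pos with rfl | hL
  · simpa [orderEntropy] using hlog
  · have h := shannonEntropy_le_log_card (m := p) (measurableSet_firstWord_fiber (A := A) L)
    rw [Fintype.card_fun, Fintype.card_fin, Nat.cast_pow, Real.logb_pow] at h
    have hL' : (0 : ℝ) < L := by exact_mod_cast hL
    rw [orderEntropy, one_div, inv_mul_le_iff₀ hL']
    exact h

theorem tendsto_orderEntropy (hp : MeasurePreserving leftShift p p) :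
    Tendsto (orderEntropy p) atTop (𝓝 (entropyRate p)) := by
  have hlim := (subadditive_shannonEntropy_firstWord hp).tendsto_lim
    ⟨0, by
      rintro _ ⟨L, rfl⟩
      exact div_nonneg (shannonEntropy_nonneg _) L.cast_nonneg⟩
  have hfun : (fun L : ℕ => shannonEntropy p (firstWord (A := A) L) / L) = orderEntropy p :=
    funext fun L => by rw [orderEntropy, one_div, div_eq_inv_mul]
  rw [hfun] at hlim
  exact tendsto_nhds_limUnder ⟨_, hlim⟩

variable [LinearOrder A]

theorem shannonEntropy_rankWord_le (L : ℕ) :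
    shannonEntropy p (rankWord (A := A) L) ≤ shannonEntropy p (firstWord (A := A) L) :=
  shannonEntropy_le_of_factorsThrough (measurableSet_firstWord_fiber L)
    (rankWord_factorsThrough_firstWord L)

/-- Passing from the letters to the ranks loses only the letter counts, which take at most
polynomially many values. -/
theorem shannonEntropy_firstWord_le (L : ℕ) :
    shannonEntropy p (firstWord (A := A) L) ≤
      shannonEntropy p (rankWord (A := A) L) + Fintype.card A * Real.logb 2 (L + 1) := by
  have hR := fun w => measurableSet_preimage_of_factorsThrough_firstWord
    (rankWord_factorsThrough_firstWord (A := A) L) {w}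
  have hN := fun w => measurableSet_preimage_of_factorsThrough_firstWord
    (cumulativeCount_factorsThrough_firstWord (A := A) L) {w}
  have hcard := shannonEntropy_le_log_card (m := p) hN
  rw [Fintype.card_fun, Fintype.card_fin, Nat.cast_pow, Real.logb_pow] at hcard
  push_cast at hcard
  refine (shannonEntropy_le_of_factorsThrough (fun z => ?_)
    (firstWord_factorsThrough_rankWord_cumulativeCount L)).trans
    ((shannonEntropy_prodMk_le hR hN).trans (by linarith))
  refine measurableSet_preimage_of_factorsThrough_firstWord (L := L) (fun s t h => ?_) {z}
  exact Prod.ext (rankWord_factorsThrough_firstWord L h)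
    (cumulativeCount_factorsThrough_firstWord L h)

theorem tendsto_natCast_div_sub_one : Tendsto (fun L : ℕ => (L : ℝ) / (L - 1)) atTop (𝓝 1) := by
  have h : Tendsto (fun L : ℕ => (1 - (1 : ℝ) / L)⁻¹) atTop (𝓝 1) := by
    simpa using (tendsto_const_nhds.sub tendsto_one_div_atTop_nhds_zero_nat).inv₀
      (a := (1 : ℝ) - 0) (by norm_num)
  refine h.congr' ?_
  filter_upwards [eventually_gt_atTop 1] with L hL
  have h1 : (1 : ℝ) < L := by exact_mod_cast hL
  have h2 : (L : ℝ) - 1 ≠ 0 := by linarith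
  have h3 : (L : ℝ) ≠ 0 := by linarith
  rw [one_sub_div h3, inv_div]

theorem tendsto_logb_add_one_div_sub_one :
    Tendsto (fun L : ℕ => Real.logb 2 (L + 1) / ((L : ℝ) - 1)) atTop (𝓝 0) := by
  have h1 : Tendsto (fun L : ℕ => Real.log ((L + 1 : ℕ) : ℝ) / ((L + 1 : ℕ) : ℝ)) atTop (𝓝 0) :=
    (Real.isLittleO_log_id_atTop.tendsto_div_nhds_zero.comp tendsto_natCast_atTop_atTop).comp
      (tendsto_add_atTop_nat 1)
  have h2 : Tendsto (fun L : ℕ => ((L + 1 : ℕ) : ℝ) / (((L + 1 : ℕ) : ℝ) - 1)) atTop (𝓝 1) :=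
    tendsto_natCast_div_sub_one.comp (tendsto_add_atTop_nat 1)
  have h3 := ((h1.mul h2).mul tendsto_natCast_div_sub_one).div_const (Real.log 2)
  simp only [zero_mul, zero_div] at h3
  refine h3.congr' ?_
  filter_upwards [eventually_gt_atTop 1] with L hL
  have h1 : (1 : ℝ) < L := by exact_mod_cast hL
  have h2 : (L : ℝ) - 1 ≠ 0 := by linarith
  have h3 : (L : ℝ) ≠ 0 := by linarith
  have h4 : (L : ℝ) + 1 ≠ 0 := by linarith
  have h5 : Real.log 2 ≠ 0 := (Real.log_pos one_lt_two).ne'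
  push_cast
  rw [add_sub_cancel_right, Real.logb]
  field_simp

/-- The permutation entropy rate of a stationary source exists and equals its entropy rate. -/
theorem tendsto_permutationEntropy (hp : MeasurePreserving leftShift p p) :
    Tendsto (permutationEntropy p) atTop (𝓝 (entropyRate p)) := by
  have hupper : Tendsto (fun L : ℕ => (L : ℝ) / (L - 1) * orderEntropy p L) atTop
      (𝓝 (entropyRate p)) := by
    simpa using tendsto_natCast_div_sub_one.mul (tendsto_orderEntropy hp)
  have hlower : Tendsto (fun L : ℕ => (L : ℝ) / (L - 1) * orderEntropy p L -
      Fintype.card A * (Real.logb 2 (L + 1) / ((L : ℝ) - 1))) atTop (𝓝 (entropyRate p)) := by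
    simpa using hupper.sub (tendsto_logb_add_one_div_sub_one.const_mul (Fintype.card A : ℝ))
  have heq : ∀ L : ℕ, 1 < L → (L : ℝ) / (L - 1) * orderEntropy p L =
      1 / ((L : ℝ) - 1) * shannonEntropy p (firstWord (A := A) L) := by
    intro L hL
    have h3 : (L : ℝ) ≠ 0 := Nat.cast_ne_zero.2 (by omega)
    rw [orderEntropy]
    field_simp
  refine tendsto_of_tendsto_of_tendsto_of_le_of_le' hlower hupper ?_ ?_
  · filter_upwards [eventually_gt_atTop 1] with L hL
    have h1 : (0 : ℝ) < (L : ℝ) - 1 := sub_pos.2 (by exact_mod_cast hL)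
    have := mul_le_mul_of_nonneg_left (shannonEntropy_firstWord_le (p := p) L)
      (one_div_nonneg.2 h1.le)
    rw [heq L hL, permutationEntropy]
    have e : (Fintype.card A : ℝ) * (Real.logb 2 (L + 1) / ((L : ℝ) - 1)) =
        1 / ((L : ℝ) - 1) * (Fintype.card A * Real.logb 2 (L + 1)) := by ring
    rw [e]
    linarith
  · filter_upwards [eventually_gt_atTop 1] with L hL
    have h1 : (0 : ℝ) < (L : ℝ) - 1 := sub_pos.2 (by exact_mod_cast hL)
    rw [heq L hL, permutationEntropy]
    exact mul_le_mul_of_nonneg_left (shannonEntropy_rankWord_le L) (one_div_nonneg.2 h1.le)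

theorem permutationEntropyRate_eq_entropyRate (hp : MeasurePreserving leftShift p p) :
    permutationEntropyRate p = entropyRate p :=
  (tendsto_permutationEntropy hp).limUnder_eq

end

/-! ### Entropy of mixtures -/

section

variable {Ω Ω' β : Type*} [MeasurableSpace Ω] [MeasurableSpace Ω'] [Fintype β]
  {κ : Kernel Ω' Ω}

theorem measurable_shannonEntropy_kernel {X : Ω → β} (hX : ∀ b, MeasurableSet (X ⁻¹' {b})) :
    Measurable fun s => shannonEntropy (κ s) X := by
  simp only [shannonEntropy_eq_sum_negMulLog]
  exact (Finset.measurable_fun_sum _ fun b _ => Real.continuous_negMulLog.measurable.comp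
    (κ.measurable_coe (hX b)).ennreal_toReal).div_const _

variable [IsMarkovKernel κ]

/-- Concavity of the entropy: by Jensen's inequality, the mean entropy of the components of a
mixture is at most the entropy of the mixture. -/
theorem integral_shannonEntropy_le {ν : Measure Ω'} [IsProbabilityMeasure ν] {m : Measure Ω}
    (hm : ∀ C, MeasurableSet C → m C = ∫⁻ s, κ s C ∂ν) {X : Ω → β}
    (hX : ∀ b, MeasurableSet (X ⁻¹' {b})) :
    ∫ s, shannonEntropy (κ s) X ∂ν ≤ shannonEntropy m X := by
  have hmeas : ∀ b, Measurable fun s => (κ s).real (X ⁻¹' {b}) := fun b =>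
    (κ.measurable_coe (hX b)).ennreal_toReal
  have hint : ∀ b, Integrable (fun s => (κ s).real (X ⁻¹' {b})) ν := fun b =>
    Integrable.of_bound (hmeas b).aestronglyMeasurable 1 (ae_of_all _ fun s => by
      rw [Real.norm_of_nonneg measureReal_nonneg]
      exact measureReal_le_one)
  have hint' : ∀ b, Integrable (fun s => Real.negMulLog ((κ s).real (X ⁻¹' {b}))) ν := fun b =>
    Integrable.of_bound
      (Real.continuous_negMulLog.measurable.comp (hmeas b)).aestronglyMeasurable 1
      (ae_of_all _ fun s => by
        rw [Real.norm_of_nonneg (Real.negMulLog_nonneg measureReal_nonneg measureReal_le_one)]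
        have := Real.self_sub_one_le_mul_log (measureReal_nonneg (μ := κ s) (s := X ⁻¹' {b}))
        have h0 : 0 ≤ (κ s).real (X ⁻¹' {b}) := measureReal_nonneg
        rw [Real.negMulLog]
        linarith)
  have hmix : ∀ b, ∫ s, (κ s).real (X ⁻¹' {b}) ∂ν = m.real (X ⁻¹' {b}) := by
    intro b
    rw [measureReal_def, hm _ (hX b)]
    exact integral_toReal (κ.measurable_coe (hX b)).aemeasurable
      (ae_of_all _ fun s => measure_lt_top _ _)
  simp only [shannonEntropy_eq_sum_negMulLog]
  rw [integral_div, integral_finsetSum _ fun b _ => hint' b]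
  refine div_le_div_of_nonneg_right (Finset.sum_le_sum fun b _ => ?_)
    (Real.log_nonneg one_le_two)
  rw [← hmix b]
  exact Real.concaveOn_negMulLog.le_map_integral Real.continuous_negMulLog.continuousOn
    isClosed_Ici (ae_of_all _ fun s => measureReal_nonneg) (hint b) (hint' b)

end

/-! ### Birkhoff averages and ergodicity -/

section

theorem tendsto_birkhoffAverage_apply_iff {Ω : Type*} {T : Ω → Ω} {f : Ω → ℝ}
    (hf : Bornology.IsBounded (Set.range f))
    {ns : ℕ → ℕ} (hns : StrictMono ns) (x : Ω) (l : ℝ) :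
    Tendsto (fun k => birkhoffAverage ℝ T f (ns k) (T x)) atTop (𝓝 l) ↔
      Tendsto (fun k => birkhoffAverage ℝ T f (ns k) x) atTop (𝓝 l) := by
  have h := (tendsto_birkhoffAverage_apply_sub_birkhoffAverage' ℝ hf T x).comp hns.tendsto_atTop
  constructor
  · intro h1
    simpa [Function.comp_def] using h1.sub h
  · intro h1
    simpa [Function.comp_def] using h1.add h

variable {Ω : Type*} [MeasurableSpace Ω] {T : Ω → Ω} {m : Measure Ω}

theorem measurable_birkhoffAverage (hT : Measurable T) {f : Ω → ℝ} (hf : Measurable f) (n : ℕ) :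
    Measurable (birkhoffAverage ℝ T f n) := by
  change Measurable fun x => (n : ℝ)⁻¹ * ∑ i ∈ Finset.range n, f (T^[i] x)
  exact (Finset.measurable_fun_sum _ fun i _ => hf.comp (hT.iterate i)).const_mul _

theorem birkhoffSum_compMeasurePreserving_toLp (hT : MeasurePreserving T m m)
    {f : Ω → ℝ} (hf : MemLp f 2 m) (n : ℕ) :
    (birkhoffSum (Lp.compMeasurePreservingₗᵢ ℝ T hT) id n (hf.toLp f) : Lp ℝ 2 m)
      =ᵐ[m] birkhoffSum T f n := by
  have hit : ∀ k, (Lp.compMeasurePreservingₗᵢ ℝ T hT)^[k] (hf.toLp f) =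
      (hf.comp_measurePreserving (hT.iterate k)).toLp _ := by
    intro k
    induction k with
    | zero => rfl
    | succ k ih =>
      rw [Function.iterate_succ_apply', ih]
      exact Lp.toLp_compMeasurePreserving _ hT
  induction n with
  | zero =>
    rw [birkhoffSum_zero, birkhoffSum_zero']
    exact Lp.coeFn_zero _ _ _
  | succ n ih =>
    rw [birkhoffSum_succ]
    filter_upwards [ih, Lp.coeFn_add (birkhoffSum (Lp.compMeasurePreservingₗᵢ ℝ T hT)
      id n (hf.toLp f)) (id ((Lp.compMeasurePreservingₗᵢ ℝ T hT)^[n] (hf.toLp f))),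
      (hf.comp_measurePreserving (hT.iterate n)).coeFn_toLp] with x h1 h2 h3
    rw [birkhoffSum_succ, h2, Pi.add_apply, h1, id, hit, h3]
    rfl

/-- A subsequence of the Birkhoff averages of a square integrable function converges almost
everywhere, because the averages converge in `L²` by the mean ergodic theorem. -/
theorem exists_subseq_birkhoffAverage_tendsto_ae (hT : MeasurePreserving T m m)
    {f : Ω → ℝ} (hf : MemLp f 2 m) :
    ∃ ns : ℕ → ℕ, StrictMono ns ∧
      ∀ᵐ x ∂m, ∃ l, Tendsto (fun k => birkhoffAverage ℝ T f (ns k) x) atTop (𝓝 l) := by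
  set U := (Lp.compMeasurePreservingₗᵢ ℝ T hT : Lp ℝ 2 m →ₗᵢ[ℝ] Lp ℝ 2 m)
  have hconv := U.toContinuousLinearMap.tendsto_birkhoffAverage_orthogonalProjection
    U.norm_toContinuousLinearMap_le (hf.toLp f)
  obtain ⟨ns, hns, hae⟩ := (tendstoInMeasure_of_tendsto_Lp hconv).exists_seq_tendsto_ae
  refine ⟨ns, hns, ?_⟩
  have hco : ∀ n, (birkhoffAverage ℝ U id n (hf.toLp f) : Lp ℝ 2 m)
      =ᵐ[m] birkhoffAverage ℝ T f n := by
    intro n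
    filter_upwards [Lp.coeFn_smul ((n : ℝ)⁻¹) (birkhoffSum U id n (hf.toLp f)),
      birkhoffSum_compMeasurePreserving_toLp hT hf n] with x h1 h2
    rw [birkhoffAverage, h1, Pi.smul_apply, h2]
    rfl
  filter_upwards [hae, ae_all_iff.2 hco] with x hx hx'
  exact ⟨_, hx.congr fun k => hx' (ns k)⟩

/-- The limit along a subsequence of the Birkhoff averages of a bounded function is an
invariant function; no null set has to be discarded, since `limUnder` depends only on the set
of limits. -/
theorem measurable_invariants_limUnder_birkhoffAverage (hT : Measurable T) {f : Ω → ℝ}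
    (hfm : Measurable f) (hf : Bornology.IsBounded (Set.range f)) {ns : ℕ → ℕ}
    (hns : StrictMono ns) :
    Measurable[MeasurableSpace.invariants T]
      fun x => limUnder atTop fun k => birkhoffAverage ℝ T f (ns k) x := by
  have hinv : (fun x => limUnder atTop fun k => birkhoffAverage ℝ T f (ns k) x) ∘ T =
      fun x => limUnder atTop fun k => birkhoffAverage ℝ T f (ns k) x := by
    funext x
    change lim (map (fun k => birkhoffAverage ℝ T f (ns k) (T x)) atTop) =
      lim (map (fun k => birkhoffAverage ℝ T f (ns k) x) atTop)
    unfold lim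
    congr 1
    funext l
    exact propext (tendsto_birkhoffAverage_apply_iff hf hns x l)
  refine MeasurableSpace.measurable_invariants_dom.2 ⟨?_, fun s _ => by rw [hinv]⟩
  refine (StronglyMeasurable.limUnder fun k => ?_).measurable
  exact (measurable_birkhoffAverage hT hfm (ns k)).stronglyMeasurable

/-- If, for every set `C` of a generating `π`-system, the visit frequencies to `C` converge
almost everywhere to a constant along some subsequence, then the system is ergodic: the constant
is `p C`, and integrating over an invariant set `B` shows that `B` and `C` are independent, so
that `B` is independent of itself. -/
theorem ergodic_of_birkhoffAverage_tendsto_const {p : Measure Ω} [IsProbabilityMeasure p]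
    (hT : MeasurePreserving T p p) {𝒞 : Set (Set Ω)}
    (hgen : ‹MeasurableSpace Ω› = MeasurableSpace.generateFrom 𝒞) (hpi : IsPiSystem 𝒞)
    (h : ∀ C ∈ 𝒞, ∃ ns : ℕ → ℕ, StrictMono ns ∧ ∃ c : ℝ, ∀ᵐ x ∂p,
      Tendsto (fun k => birkhoffAverage ℝ T (C.indicator 1) (ns k) x) atTop (𝓝 c)) :
    Ergodic T p := by
  have hmeas : ∀ C ∈ 𝒞, MeasurableSet C := fun C hC => by
    rw [hgen]
    exact MeasurableSpace.measurableSet_generateFrom hC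
  have hlim : ∀ C ∈ 𝒞, ∃ c : ℝ, ∀ B, MeasurableSet B → T ⁻¹' B = B →
      p.real (C ∩ B) = c * p.real B := by
    intro C hC
    obtain ⟨ns, hns, c, hc⟩ := h C hC
    refine ⟨c, fun B hB hTB => ?_⟩
    have hint : ∀ i : ℕ, Integrable (fun x => C.indicator (1 : Ω → ℝ) (T^[i] x))
        (p.restrict B) := fun i =>
      Integrable.of_bound (((measurable_one.indicator (hmeas C hC)).comp
        (hT.measurable.iterate i)).aestronglyMeasurable) 1 (ae_of_all _ fun x => by
          by_cases hx : T^[i] x ∈ C <;> simp [hx])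
    have hterm : ∀ i : ℕ, ∫ x in B, C.indicator (1 : Ω → ℝ) (T^[i] x) ∂p = p.real (C ∩ B) := by
      intro i
      have hTi : T^[i] ⁻¹' B = B := Function.IsFixedPt.preimage_iterate hTB i
      have e : (fun x => C.indicator (1 : Ω → ℝ) (T^[i] x)) =
          (T^[i] ⁻¹' C).indicator 1 := rfl
      rw [e, integral_indicator_one ((hmeas C hC).preimage (hT.measurable.iterate i)),
        measureReal_restrict_apply ((hmeas C hC).preimage (hT.measurable.iterate i))]
      conv_lhs => rw [← hTi, ← Set.preimage_inter]
      rw [measureReal_def, (hT.iterate i).measure_preimage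
        ((hmeas C hC).inter hB).nullMeasurableSet, measureReal_def]
    have havg : ∀ n : ℕ, n ≠ 0 →
        ∫ x in B, birkhoffAverage ℝ T (C.indicator (1 : Ω → ℝ)) n x ∂p = p.real (C ∩ B) := by
      intro n hn
      simp only [birkhoffAverage, birkhoffSum, smul_eq_mul]
      rw [integral_const_mul, integral_finsetSum _ fun i _ => hint i,
        Finset.sum_congr rfl fun i _ => hterm i]
      have : (n : ℝ) ≠ 0 := Nat.cast_ne_zero.2 hn
      simp [this]
    have hdct : Tendsto (fun k => ∫ x in B, birkhoffAverage ℝ T (C.indicator (1 : Ω → ℝ))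
        (ns k) x ∂p) atTop (𝓝 (∫ _ in B, c ∂p)) := by
      refine tendsto_integral_of_dominated_convergence (fun _ => 1) (fun k => ?_)
        (integrable_const _) (fun k => ae_of_all _ fun x => ?_) (ae_restrict_of_ae hc)
      · exact (measurable_birkhoffAverage hT.measurable
          (measurable_one.indicator (hmeas C hC)) (ns k)).aestronglyMeasurable
      · rw [birkhoffAverage, norm_smul, norm_inv, Real.norm_natCast, birkhoffSum]
        have h1 : ‖∑ i ∈ Finset.range (ns k), C.indicator (1 : Ω → ℝ) (T^[i] x)‖ ≤ ns k :=
          (norm_sum_le_of_le _ (n := fun _ => (1 : ℝ)) fun i _ => by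
            by_cases hx : T^[i] x ∈ C <;> simp [hx]).trans_eq (by simp)
        rcases (ns k).eq_zero_or_pos with h0 | h0
        · simp [h0]
        · have : (0 : ℝ) < ns k := by exact_mod_cast h0
          rw [inv_mul_le_iff₀ this, mul_one]
          exact h1
    have hconst : Tendsto (fun k => ∫ x in B, birkhoffAverage ℝ T (C.indicator (1 : Ω → ℝ))
        (ns k) x ∂p) atTop (𝓝 (p.real (C ∩ B))) := by
      refine tendsto_const_nhds.congr' ?_
      filter_upwards [eventually_gt_atTop 0] with k hk
      exact (havg (ns k) (Nat.ne_zero_of_lt (hk.trans_le (hns.id_le k)))).symm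
    rw [tendsto_nhds_unique hconst hdct, integral_const, measureReal_restrict_apply_univ,
      smul_eq_mul, mul_comm]
  refine ⟨hT, ⟨fun B hB hTB => ?_⟩⟩
  have hind : ∀ C ∈ 𝒞, p (C ∩ B) = p C * p B := by
    intro C hC
    obtain ⟨c, hc⟩ := hlim C hC
    have h1 := hc Set.univ MeasurableSet.univ rfl
    have h2 := hc B hB hTB
    rw [Set.inter_univ, probReal_univ, mul_one] at h1
    rw [← h1] at h2
    rw [← ENNReal.toReal_eq_toReal_iff' (measure_ne_top _ _) (by finiteness), ENNReal.toReal_mul]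
    exact h2
  -- `B` is independent of every measurable set, in particular of its complement
  have hext : p.restrict B = p B • p := by
    refine ext_of_generate_finite 𝒞 hgen hpi (fun C hC => ?_) ?_
    · rw [Measure.restrict_apply (hmeas C hC), hind C hC, Measure.smul_apply, smul_eq_mul, mul_comm]
    · simp
  have hBc := congrArg (fun ν => ν Bᶜ) hext
  simp only [Measure.restrict_apply hB.compl, Set.compl_inter_self, measure_empty,
    Measure.smul_apply, smul_eq_mul] at hBc
  rw [eventuallyConst_set']
  rcases mul_eq_zero.1 hBc.symm with h0 | h0
  · exact Or.inl (ae_eq_empty.2 h0)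
  · exact Or.inr (ae_eq_univ.2 h0)

end

/-! ### Conditioning on the invariant sets -/

section

variable {Ω : Type*} {I : MeasurableSpace Ω} [mΩ : MeasurableSpace Ω] [StandardBorelSpace Ω]
  {m : Measure Ω} [IsProbabilityMeasure m]

theorem ae_ae_condExpKernel (hI : I ≤ mΩ) {P : Ω → Prop}
    (h : ∀ᵐ t ∂m, P t) : ∀ᵐ s ∂m, ∀ᵐ t ∂(condExpKernel m I s), P t := by
  rw [← condExpKernel_comp_trim (μ := m) hI] at h
  exact ae_of_ae_trim hI (Measure.ae_ae_of_ae_comp h)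

/-- Conditioning on `I` fixes the value of every `I`-measurable function: the joint law of a point
and of a sample of its conditional measure is, on `I ⊗ mΩ`, carried by the diagonal. -/
theorem ae_ae_condExpKernel_eq (hI : I ≤ mΩ) {f : Ω → ℝ}
    (hf : Measurable[I] f) : ∀ᵐ s ∂m, ∀ᵐ t ∂(condExpKernel m I s), f t = f s := by
  have hset : MeasurableSet[I.prod mΩ] {z : Ω × Ω | f z.2 = f z.1} :=
    @measurableSet_eq_fun _ _ (I.prod mΩ) _ _ _ _
      ((hf.mono hI le_rfl).comp (@measurable_snd _ _ I mΩ)) (hf.comp (@measurable_fst _ _ I mΩ))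
  have hdiag : @Measurable Ω (Ω × Ω) mΩ (I.prod mΩ) Function.diag :=
    @Measurable.prodMk _ mΩ _ _ I mΩ _ _ (measurable_id'' hI) measurable_id
  refine ae_of_ae_trim hI (Measure.ae_ae_of_ae_compProd (p := fun z => f z.2 = f z.1) ?_)
  rw [compProd_trim_condExpKernel hI, @ae_map_iff _ _ mΩ (I.prod mΩ) _ _
    (@Measurable.aemeasurable _ _ mΩ (I.prod mΩ) _ _ hdiag) _ hset]
  exact ae_of_all _ fun s => rfl

theorem lintegral_condExpKernel_apply (hI : I ≤ mΩ) {C : Set Ω}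
    (hC : MeasurableSet C) : ∫⁻ s, condExpKernel m I s C ∂m = m C := by
  conv_rhs => rw [← condExpKernel_comp_trim (μ := m) hI]
  rw [Measure.bind_apply hC (condExpKernel m I).aemeasurable,
    lintegral_trim hI (measurable_condExpKernel hC)]

variable (Ω) in
/-- A standard Borel space has a countable generating `π`-system. -/
theorem exists_countable_isPiSystem_generateFrom : ∃ 𝒞 : Set (Set Ω), 𝒞.Countable ∧
    IsPiSystem 𝒞 ∧ mΩ = MeasurableSpace.generateFrom 𝒞 :=
  ⟨generateSetAlgebra (MeasurableSpace.countableGeneratingSet Ω),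
    countable_generateSetAlgebra MeasurableSpace.countable_countableGeneratingSet,
    isSetAlgebra_generateSetAlgebra.isSetRing.isSetSemiring.isPiSystem,
    by rw [generateFrom_generateSetAlgebra_eq,
      MeasurableSpace.generateFrom_countableGeneratingSet]⟩

theorem ae_ae_condExpKernel_eq_condExpKernel (hI : I ≤ mΩ) :
    ∀ᵐ s ∂m, ∀ᵐ t ∂(condExpKernel m I s), condExpKernel m I t = condExpKernel m I s := by
  obtain ⟨𝒞, hcount, hpi, hgen⟩ := exists_countable_isPiSystem_generateFrom Ω
  have hmeas : ∀ C ∈ 𝒞, MeasurableSet C := fun C hC => by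
    rw [hgen]
    exact MeasurableSpace.measurableSet_generateFrom hC
  have h := (ae_ball_iff hcount).2 fun C hC => ae_ae_condExpKernel_eq (m := m) hI
    (measurable_condExpKernel (μ := m) (m := I) (hmeas C hC)).ennreal_toReal
  filter_upwards [h] with s hs
  filter_upwards [(ae_ball_iff hcount).2 hs] with t ht
  refine ext_of_generate_finite 𝒞 hgen hpi (fun C hC => ?_) (by simp)
  exact (ENNReal.toReal_eq_toReal_iff' (measure_ne_top _ _) (measure_ne_top _ _)).1 (ht C hC)

variable {T : Ω → Ω}

/-- The equality holds at every `s`, since the kernel is measurable with respect to the invariant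
sets. -/
theorem condExpKernel_invariants_apply_apply (s : Ω) :
    condExpKernel m (MeasurableSpace.invariants T) (T s) =
      condExpKernel m (MeasurableSpace.invariants T) s := by
  refine Measure.ext fun C hC => ?_
  exact congrFun (MeasurableSpace.comp_eq_of_measurable_invariants
    (measurable_condExpKernel (μ := m) (m := MeasurableSpace.invariants T) hC)) s

theorem ae_measurePreserving_condExpKernel_invariants (hT : MeasurePreserving T m m) :
    ∀ᵐ s ∂m, MeasurePreserving T (condExpKernel m (MeasurableSpace.invariants T) s)
      (condExpKernel m (MeasurableSpace.invariants T) s) := by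
  have hI := MeasurableSpace.invariants_le T
  obtain ⟨𝒞, hcount, hpi, hgen⟩ := exists_countable_isPiSystem_generateFrom Ω
  have hmeas : ∀ C ∈ 𝒞, MeasurableSet C := fun C hC => by
    rw [hgen]
    exact MeasurableSpace.measurableSet_generateFrom hC
  have hC : ∀ C ∈ 𝒞, ∀ᵐ s ∂m, (condExpKernel m (MeasurableSpace.invariants T) s).real (T ⁻¹' C) =
      (condExpKernel m (MeasurableSpace.invariants T) s).real C := by
    intro C hC
    have hCm := hmeas C hC
    have hTC := hCm.preimage hT.measurable
    refine (condExpKernel_ae_eq_condExp hI hTC).trans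
      (Filter.EventuallyEq.trans ?_ (condExpKernel_ae_eq_condExp hI hCm).symm)
    -- on an invariant set `B`, the sets `C` and `T ⁻¹' C` have the same mass
    refine (ae_eq_condExp_of_forall_setIntegral_eq hI ((integrable_const (1 : ℝ)).indicator hTC)
      (fun _ _ _ => integrable_condExp.integrableOn) (fun B hB _ => ?_)
      stronglyMeasurable_condExp.aestronglyMeasurable).symm
    rw [setIntegral_condExp hI ((integrable_const (1 : ℝ)).indicator hCm) hB]
    have e : ∀ D : Set Ω, MeasurableSet D →
        ∫ x in B, D.indicator (fun _ => (1 : ℝ)) x ∂m = m.real (D ∩ B) := fun D hD => by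
      rw [← measureReal_restrict_apply hD]
      exact integral_indicator_one hD
    rw [e _ hCm, e _ hTC]
    conv_rhs => rw [← hB.2, ← Set.preimage_inter]
    rw [measureReal_def, measureReal_def,
      hT.measure_preimage (hCm.inter hB.1).nullMeasurableSet]
  filter_upwards [(ae_ball_iff hcount).2 hC] with s hs
  have := Measure.isProbabilityMeasure_map (μ := condExpKernel m (MeasurableSpace.invariants T) s)
    hT.measurable.aemeasurable
  refine ⟨hT.measurable, ext_of_generate_finite 𝒞 hgen hpi (fun C hC => ?_) (by simp)⟩
  rw [Measure.map_apply hT.measurable (hmeas C hC)]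
  exact (ENNReal.toReal_eq_toReal_iff' (measure_ne_top _ _) (measure_ne_top _ _)).1 (hs C hC)

/-- **Ergodic decomposition**: conditioning an invariant measure on the `σ`-algebra of invariant
sets almost surely gives an ergodic measure. -/
theorem ae_ergodic_condExpKernel_invariants (hT : MeasurePreserving T m m) :
    ∀ᵐ s ∂m, Ergodic T (condExpKernel m (MeasurableSpace.invariants T) s) := by
  have hI := MeasurableSpace.invariants_le T
  obtain ⟨𝒞, hcount, hpi, hgen⟩ := exists_countable_isPiSystem_generateFrom Ω
  have hmeas : ∀ C ∈ 𝒞, MeasurableSet C := fun C hC => by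
    rw [hgen]
    exact MeasurableSpace.measurableSet_generateFrom hC
  have h : ∀ C ∈ 𝒞, ∀ᵐ s ∂m, ∃ ns : ℕ → ℕ, StrictMono ns ∧ ∃ c : ℝ,
      ∀ᵐ x ∂(condExpKernel m (MeasurableSpace.invariants T) s),
        Tendsto (fun k => birkhoffAverage ℝ T (C.indicator 1) (ns k) x) atTop (𝓝 c) := by
    intro C hC
    have hbdd : Bornology.IsBounded (Set.range (C.indicator (1 : Ω → ℝ))) :=
      Metric.isBounded_Icc (0 : ℝ) 1 |>.subset (by
        rintro _ ⟨x, rfl⟩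
        by_cases hx : x ∈ C <;> simp [hx])
    have hind : Measurable (C.indicator (1 : Ω → ℝ)) := measurable_one.indicator (hmeas C hC)
    have hLp : MemLp (C.indicator (1 : Ω → ℝ)) 2 m :=
      MemLp.of_bound hind.aestronglyMeasurable 1 (ae_of_all _ fun x => by
        by_cases hx : x ∈ C <;> simp [hx])
    obtain ⟨ns, hns, hconv⟩ := exists_subseq_birkhoffAverage_tendsto_ae hT hLp
    filter_upwards [ae_ae_condExpKernel hI hconv, ae_ae_condExpKernel_eq hI
      (measurable_invariants_limUnder_birkhoffAverage hT.measurable hind hbdd hns)] with s h1 h2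
    refine ⟨ns, hns, limUnder atTop fun k => birkhoffAverage ℝ T (C.indicator 1) (ns k) s, ?_⟩
    filter_upwards [h1, h2] with x hx1 hx2
    exact hx2 ▸ tendsto_nhds_limUnder hx1
  filter_upwards [(ae_ball_iff hcount).2 h, ae_measurePreserving_condExpKernel_invariants hT]
    with s hs hTs
  exact ergodic_of_birkhoffAverage_tendsto_const hTs hgen hpi hs

end

/-! ### Permutation entropy and ergodic decompositions -/

section

variable {A : Type*} [Fintype A] [MeasurableSpace A] [MeasurableSingletonClass A]
  {m : Measure (ℕ → A)}

theorem exists_isErgodicDecomposition [IsProbabilityMeasure m]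
    (hm : MeasurePreserving leftShift m m) :
    ∃ κ : Kernel (ℕ → A) (ℕ → A), IsErgodicDecomposition m κ := by
  have hA : DiscreteMeasurableSpace A := MeasurableSingletonClass.toDiscreteMeasurableSpace
  have hI := MeasurableSpace.invariants_le (leftShift (A := A))
  refine ⟨(condExpKernel m (MeasurableSpace.invariants leftShift)).comap id
    (measurable_id'' hI), ⟨inferInstance, ?_, ?_, ?_, fun C hC => ?_⟩⟩
  · exact ae_ergodic_condExpKernel_invariants hm
  · exact ae_of_all _ fun s => condExpKernel_invariants_apply_apply s
  · exact ae_ae_condExpKernel_eq_condExpKernel hI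
  · exact (lintegral_condExpKernel_apply hI hC).symm

theorem measurable_orderEntropy_kernel {κ : Kernel (ℕ → A) (ℕ → A)} (L : ℕ) :
    Measurable fun s => orderEntropy (κ s) L :=
  (measurable_shannonEntropy_kernel (measurableSet_firstWord_fiber L)).const_mul _

variable [LinearOrder A]

theorem IsErgodicDecomposition.ae_tendsto_permutationEntropy {κ : Kernel (ℕ → A) (ℕ → A)}
    (hκ : IsErgodicDecomposition m κ) :
    ∀ᵐ s ∂m, Tendsto (permutationEntropy (κ s)) atTop (𝓝 (permutationEntropyRate (κ s))) := by
  have := hκ.isMarkovKernel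
  filter_upwards [hκ.ergodic] with s hs
  exact tendsto_nhds_limUnder ⟨_, tendsto_permutationEntropy hs.toMeasurePreserving⟩

theorem IsErgodicDecomposition.ae_tendsto_orderEntropy {κ : Kernel (ℕ → A) (ℕ → A)}
    (hκ : IsErgodicDecomposition m κ) :
    ∀ᵐ s ∂m, Tendsto (fun L => orderEntropy (κ s) L) atTop
      (𝓝 (permutationEntropyRate (κ s))) := by
  have := hκ.isMarkovKernel
  filter_upwards [hκ.ergodic] with s hs
  rw [permutationEntropyRate_eq_entropyRate hs.toMeasurePreserving]
  exact tendsto_orderEntropy hs.toMeasurePreserving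

variable [IsProbabilityMeasure m]

theorem IsErgodicDecomposition.integrable_permutationEntropyRate
    {κ : Kernel (ℕ → A) (ℕ → A)} (hκ : IsErgodicDecomposition m κ) :
    Integrable (fun s => permutationEntropyRate (κ s)) m := by
  have := hκ.isMarkovKernel
  refine Integrable.of_bound (aestronglyMeasurable_of_tendsto_ae atTop
    (fun L => (measurable_orderEntropy_kernel L).aestronglyMeasurable) hκ.ae_tendsto_orderEntropy)
    (Real.logb 2 (Fintype.card A)) ?_
  filter_upwards [hκ.ae_tendsto_orderEntropy] with s hs
  rw [Real.norm_of_nonneg (ge_of_tendsto' hs orderEntropy_nonneg)]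
  exact le_of_tendsto' hs orderEntropy_le_log_card

/-- The integral inequality passes to the limit from the concavity of the entropies of finite
order, which are uniformly bounded by the logarithm of the size of the alphabet. -/
theorem IsErgodicDecomposition.integral_permutationEntropyRate_le
    {κ : Kernel (ℕ → A) (ℕ → A)} (hκ : IsErgodicDecomposition m κ)
    (hm : MeasurePreserving leftShift m m) :
    ∫ s, permutationEntropyRate (κ s) ∂m ≤ permutationEntropyRate m := by
  have := hκ.isMarkovKernel
  have hlim : Tendsto (fun L => ∫ s, orderEntropy (κ s) L ∂m) atTop
      (𝓝 (∫ s, permutationEntropyRate (κ s) ∂m)) := by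
    refine tendsto_integral_of_dominated_convergence
      (fun _ => Real.logb 2 (Fintype.card A))
      (fun L => (measurable_orderEntropy_kernel L).aestronglyMeasurable) (integrable_const _)
      (fun L => ae_of_all _ fun s => ?_) hκ.ae_tendsto_orderEntropy
    rw [Real.norm_of_nonneg (orderEntropy_nonneg L)]
    exact orderEntropy_le_log_card L
  rw [permutationEntropyRate_eq_entropyRate hm]
  refine le_of_tendsto_of_tendsto' hlim (tendsto_orderEntropy hm) fun L => ?_
  simp only [orderEntropy]
  rw [integral_const_mul]
  exact mul_le_mul_of_nonneg_left
    (integral_shannonEntropy_le hκ.mixture (measurableSet_firstWord_fiber L)) (by positivity)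

end

theorem IsStationaryProcess.measurePreserving_leftShift {Ω A : Type*}
    [MeasurableSpace Ω] [MeasurableSpace A] {μ : Measure Ω} {S : ℕ → Ω → A}
    (hS : ∀ n, Measurable (S n)) (hstat : IsStationaryProcess μ S) :
    MeasurePreserving leftShift (sourceModel μ S) (sourceModel μ S) := by
  refine ⟨measurable_leftShift, ?_⟩
  rw [sourceModel, Measure.map_map measurable_leftShift (measurable_pi_lambda _ hS)]
  exact hstat 1

theorem mainTheorem5 {Ω A : Type*} [MeasurableSpace Ω]
    [Fintype A] [LinearOrder A] [MeasurableSpace A] [MeasurableSingletonClass A]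
    (μ : Measure Ω) [IsProbabilityMeasure μ]
    (S : ℕ → Ω → A) (hS : ∀ n, Measurable (S n)) (hstat : IsStationaryProcess μ S)
    (m : Measure (ℕ → A)) (hm : m = sourceModel μ S)
    (hlim : ∃ h : ℝ, Tendsto (permutationEntropy m) atTop (𝓝 h)) :
    (Tendsto (orderEntropy m) atTop (𝓝 (entropyRate m)) ∧
      entropyRate m ≤ permutationEntropyRate m) ∧
    (∃ κ : Kernel (ℕ → A) (ℕ → A), IsErgodicDecomposition m κ) ∧
    ∀ κ : Kernel (ℕ → A) (ℕ → A), IsErgodicDecomposition m κ →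
      (∀ᵐ s ∂m, Tendsto (permutationEntropy (κ s)) atTop
        (𝓝 (permutationEntropyRate (κ s)))) ∧
      Integrable (fun s => permutationEntropyRate (κ s)) m ∧
      ∫ s, permutationEntropyRate (κ s) ∂m ≤ permutationEntropyRate m := by
  subst hm
  have hprob : IsProbabilityMeasure (sourceModel μ S) :=
    Measure.isProbabilityMeasure_map (measurable_pi_lambda _ hS).aemeasurable
  have hinv := hstat.measurePreserving_leftShift hS
  exact ⟨⟨tendsto_orderEntropy hinv, (permutationEntropyRate_eq_entropyRate hinv).ge⟩,
    exists_isErgodicDecomposition hinv, fun κ hκ => ⟨hκ.ae_tendsto_permutationEntropy,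
      hκ.integrable_permutationEntropyRate, hκ.integral_permutationEntropyRate_le hinv⟩⟩
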